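/- Let $n\ge 1$, $B>0$. Let $\mathbb R_n$ be the real Clifford algebra generated by $e_1,\dots,e_n$ with $e_re_s+e_se_r=-2\delta_{rs}$ and norm $|\sum_A a_Ae_A|^2=\sum_A a_A^2$. Identify $\mathbb R^{n+1}$ with the paravectors $x=x_0+\underline x$, $\underline x=x_1e_1+\dots+x_ne_n$, put $\mathbb S=\{\underline x:|\underline x|=1\}$, and write $I_x=\underline x/|\underline x|$ if $\underline x\ne0$, while for real $x$ the symbol $I_x$ denotes an arbitrary element of $\mathbb S$; thus $x=u+I_xv$ with $u=x_0$, $v=|\underline x|$. A function $f:\mathbb R^{n+1}\to\mathbb R_n$ is left slice monogenic if it is real differentiable and $\frac12(\partial_u+I\partial_v)f(u+Iv)=0$ for all $I\in\mathbb S$ and $u,v\in\mathbb R$. For $I\in\mathbb S$ let $\mathscr F_I g(w)=\frac1{\sqrt{2\pi}}\int_{\mathbb R}e^{-Iuw}g(u)\,du$ for $g\in L^1(\mathbb R;\mathbb R_n)$; for $g\in L^2(\mathbb R;\mathbb R_n)$ let $\mathscr F_Ig$ be the $L^2$-limit, as $T\to\infty$, of $\mathscr F_I(g\mathbf 1_{[-T,T]})$.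 The slice monogenic Paley–Wiener space is $$PW_B^2(\mathbb R^{n+1})=\{f \text{ left slice monogenic on }\mathbb R^{n+1}:\ f|_{\mathbb R}\in L^2(\mathbb R),\ \operatorname{supp}\mathscr F_I(f|_{\mathbb R})\subset[-B,B]\ \text{for every } I\in\mathbb S\}.$$ For $I\in\mathbb S$ and $u,v,\xi,\eta\in\mathbb R$ let $K_{B,L_I}(u+Iv,\xi+I\eta)=\frac1{2\pi}\int_{-B}^{B}e^{I[(u+Iv)-(\xi-I\eta)]w}\,dw$, and let $K_{B,\mathbb R^{n+1}}(\cdot,\xi+I\eta)$ be its slice extension to $\mathbb R^{n+1}$: for $x=u+I_xv$ as above and $\zeta=\xi+I\eta$, $$K_{B,\mathbb R^{n+1}}(x,\zeta)=\tfrac12\big[K_{B,L_I}(u-Iv,\zeta)+K_{B,L_I}(u+Iv,\zeta)\big]+\tfrac{I_xI}{2}\big[K_{B,L_I}(u-Iv,\zeta)-K_{B,L_I}(u+Iv,\zeta)\big].$$ Then, for every choice of $I\in\mathbb S$ in this construction: (1) for every $f\in PW_B^2(\mathbb R^{n+1})$ and every $x\in\mathbb R^{n+1}$, the function $\xi\mapsto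 K_{B,\mathbb R^{n+1}}(x,\xi)f(\xi)$ is integrable on $\mathbb R$ and $$f(x)=\int_{\mathbb R}K_{B,\mathbb R^{n+1}}(x,\xi)\,f(\xi)\,d\xi ;$$ (2) for every $x\in\mathbb R^{n+1}$ and $\xi\in\mathbb R$ (and, for real $x$, every choice of $I_x\in\mathbb S$), $$K_{B,\mathbb R^{n+1}}(x,\xi)=\frac1{2\pi}\int_{-B}^{B}e^{I_x(x-\xi)w}\,dw .$$ -/

import Mathlib

open MeasureTheory Filter Topology
open scoped ENNReal

namespace SliceMonogenic

/-- The quadratic form `v ↦ -|v|²` on Euclidean `n`-space. -/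
noncomputable def cliffordForm (n : ℕ) : QuadraticForm ℝ (EuclideanSpace ℝ (Fin n)) :=
  -LinearMap.BilinMap.toQuadraticMap (innerₗ (EuclideanSpace ℝ (Fin n)))

/-- The real Clifford algebra `ℝ_n` over `n` imaginary units `e_1, …, e_n` with
`e_r e_s + e_s e_r = -2 δ_{rs}`. -/
abbrev Cl (n : ℕ) : Type := CliffordAlgebra (cliffordForm n)

/-- The inclusion of the vectors `x_1 e_1 + … + x_n e_n` into `ℝ_n`. -/
noncomputable abbrev vec {n : ℕ} (v : EuclideanSpace ℝ (Fin n)) : Cl n :=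
  CliffordAlgebra.ι (cliffordForm n) v

/-- The imaginary units. -/
noncomputable def e {n : ℕ} (i : Fin n) : Cl n := vec (EuclideanSpace.single i (1 : ℝ))

/-- `e_A = e_{i_1} ⋯ e_{i_s}` for `A = {i_1 < … < i_s}`, and `e_∅ = 1`. -/
noncomputable def eProd {n : ℕ} (A : Finset (Fin n)) : Cl n := ((A.sort (· ≤ ·)).map e).prod

theorem cliffordForm_apply {n : ℕ} (v : EuclideanSpace ℝ (Fin n)) :
    cliffordForm n v = -‖v‖ ^ 2 := by
  simp [cliffordForm, LinearMap.BilinMap.toQuadraticMap_apply]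

theorem e_mul_self {n : ℕ} (i : Fin n) : (e i * e i : Cl n) = -1 := by
  rw [e, CliffordAlgebra.ι_sq_scalar, cliffordForm_apply]
  simp

theorem e_mul_e {n : ℕ} {i j : Fin n} (h : i ≠ j) : (e i * e j : Cl n) = -(e j * e i) := by
  have key := CliffordAlgebra.ι_mul_ι_add_swap (Q := cliffordForm n)
    (EuclideanSpace.single i (1 : ℝ)) (EuclideanSpace.single j (1 : ℝ))
  have h0 : QuadraticMap.polar (cliffordForm n) (EuclideanSpace.single i (1 : ℝ))
      (EuclideanSpace.single j (1 : ℝ)) = 0 := by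
    have hin : inner ℝ (EuclideanSpace.single i (1 : ℝ)) (EuclideanSpace.single j (1 : ℝ)) = 0 := by
      simp [EuclideanSpace.inner_single_left, h]
    rw [QuadraticMap.polar, cliffordForm_apply, cliffordForm_apply, cliffordForm_apply,
      @norm_add_sq ℝ, hin]
    simp
  rw [h0, map_zero] at key
  exact eq_neg_of_add_eq_zero_left key

theorem eProd_empty {n : ℕ} : (eProd ∅ : Cl n) = 1 := by simp [eProd]

theorem eProd_insert {n : ℕ} {a : Fin n} {s : Finset (Fin n)} (h : ∀ x ∈ s, a < x) :
    eProd (insert a s) = e a * eProd s := by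
  have ha : a ∉ s := fun hs => lt_irrefl _ (h a hs)
  have hs : (insert a s).sort (· ≤ ·) = a :: s.sort (· ≤ ·) :=
    Finset.sort_insert _ (fun b hb => (h b hb).le) ha
  rw [eProd, hs, List.map_cons, List.prod_cons, eProd]

/-- Contraction with the `a`-th coordinate. -/
noncomputable def contr {n : ℕ} (a : Fin n) : Cl n →ₗ[ℝ] Cl n :=
  CliffordAlgebra.contractLeft
    ((EuclideanSpace.proj a : EuclideanSpace ℝ (Fin n) →L[ℝ] ℝ) : Module.Dual ℝ _)

theorem contr_e_mul {n : ℕ} (a i : Fin n) (x : Cl n) :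
    contr a (e i * x) = (if a = i then x else 0) - e i * contr a x := by
  rw [contr, e, CliffordAlgebra.contractLeft_ι_mul]
  by_cases h : a = i <;> simp [h]

theorem contr_eProd {n : ℕ} (a : Fin n) (s : Finset (Fin n)) (h : a ∉ s) :
    contr a (eProd s) = 0 := by
  induction s using Finset.induction_on_min with
  | empty => rw [eProd_empty, contr, CliffordAlgebra.contractLeft_one]
  | insert b s hb ih =>
    rw [Finset.mem_insert, not_or] at h
    rw [eProd_insert hb, contr_e_mul, ih h.2, if_neg h.1]
    simp

theorem eProd_indep {n : ℕ} (s : Finset (Fin n)) (c : Finset (Fin n) → ℝ)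
    (h : ∑ A ∈ s.powerset, c A • (eProd A : Cl n) = 0) : ∀ A ∈ s.powerset, c A = 0 := by
  induction s using Finset.induction_on_min generalizing c with
  | empty =>
    intro A hA
    simp only [Finset.powerset_empty, Finset.mem_singleton] at hA
    subst hA
    simpa [eProd_empty] using h
  | insert a s ha ih =>
    have has : a ∉ s := fun hs => lt_irrefl _ (ha a hs)
    rw [Finset.sum_powerset_insert has] at h
    have h2 : ∑ A ∈ s.powerset, c (insert a A) • (eProd (insert a A) : Cl n) =
        e a * ∑ A ∈ s.powerset, c (insert a A) • (eProd A : Cl n) := by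
      rw [Finset.mul_sum]
      refine Finset.sum_congr rfl fun A hA => ?_
      rw [eProd_insert fun x hx => ha x (Finset.mem_powerset.1 hA hx), mul_smul_comm]
    have hz : ∀ d : Finset (Fin n) → ℝ,
        contr a (∑ A ∈ s.powerset, d A • (eProd A : Cl n)) = 0 := by
      intro d
      rw [map_sum]
      refine Finset.sum_eq_zero fun A hA => ?_
      rw [map_smul, contr_eProd a A fun hx => has (Finset.mem_powerset.1 hA hx), smul_zero]
    have h3 : ∑ A ∈ s.powerset, c (insert a A) • (eProd A : Cl n) = 0 := by
      have := congrArg (contr a) h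
      rw [h2, map_add, hz, contr_e_mul, if_pos rfl, hz (fun A => c (insert a A))] at this
      simpa using this
    rw [h2, h3, mul_zero, add_zero] at h
    have i1 := ih c h
    have i2 := ih (fun A => c (insert a A)) h3
    intro A hA
    by_cases haA : a ∈ A
    · have := i2 (A.erase a) (Finset.mem_powerset.2 fun x hx => by
        have hx' := Finset.mem_erase.1 hx
        exact (Finset.mem_insert.1 (Finset.mem_powerset.1 hA hx'.2)).resolve_left hx'.1)
      simpa [Finset.insert_erase haA] using this
    · exact i1 A (Finset.mem_powerset.2 fun x hx =>
        (Finset.mem_insert.1 (Finset.mem_powerset.1 hA hx)).resolve_left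
          fun hxa => haA (hxa ▸ hx))

theorem eProd_linearIndependent (n : ℕ) :
    LinearIndependent ℝ (eProd : Finset (Fin n) → Cl n) := by
  rw [Fintype.linearIndependent_iff]
  intro c hc A
  exact eProd_indep Finset.univ c (by simpa using hc) A (by simp)

theorem e_mul_eProd_mem {n : ℕ} (s : Finset (Fin n)) (i : Fin n) :
    (e i * eProd s : Cl n) ∈
      Submodule.span ℝ (eProd '' {B : Finset (Fin n) | B ⊆ insert i s}) := by
  induction s using Finset.induction_on_min with
  | empty =>
    refine Submodule.subset_span ⟨{i}, by simp, ?_⟩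
    rw [← insert_empty_eq, eProd_insert (by simp)]
  | insert a s ha ih =>
    rcases lt_trichotomy i a with h | h | h
    · refine Submodule.subset_span ⟨insert i (insert a s), by simp, ?_⟩
      rw [eProd_insert]
      intro x hx
      rcases Finset.mem_insert.1 hx with rfl | hx
      · exact h
      · exact h.trans (ha x hx)
    · subst h
      rw [eProd_insert ha, ← mul_assoc, e_mul_self, neg_one_mul]
      refine Submodule.neg_mem _ (Submodule.subset_span ⟨s, ?_, rfl⟩)
      intro x hx
      simp [hx]
    · rw [eProd_insert ha, ← mul_assoc, e_mul_e h.ne', neg_mul, mul_assoc]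
      refine Submodule.neg_mem _ ?_
      have hle : Submodule.span ℝ (eProd '' {B : Finset (Fin n) | B ⊆ insert i s}) ≤
          (Submodule.span ℝ (eProd '' {B : Finset (Fin n) | B ⊆ insert i (insert a s)})).comap
            (LinearMap.mulLeft ℝ (e a : Cl n)) := by
        rw [Submodule.span_le]
        rintro _ ⟨B, hB, rfl⟩
        refine Submodule.subset_span ⟨insert a B, ?_, ?_⟩
        · intro x hx
          rcases Finset.mem_insert.1 hx with rfl | hx
          · simp
          · have := Finset.mem_insert.1 (hB hx)
            simp only [Finset.mem_insert]
            tauto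
        · rw [eProd_insert, LinearMap.mulLeft_apply]
          intro x hx
          rcases Finset.mem_insert.1 (hB hx) with rfl | hx
          · exact h
          · exact ha x hx
      exact hle ih

theorem eProd_span (n : ℕ) : ⊤ ≤ Submodule.span ℝ (Set.range (eProd : Finset (Fin n) → Cl n)) := by
  have hmul : ∀ (i : Fin n) (x : Cl n), x ∈ Submodule.span ℝ (Set.range (eProd (n := n))) →
      e i * x ∈ Submodule.span ℝ (Set.range (eProd (n := n))) := by
    intro i
    have hle : Submodule.span ℝ (Set.range (eProd (n := n))) ≤
        (Submodule.span ℝ (Set.range (eProd (n := n)))).comap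
          (LinearMap.mulLeft ℝ (e i : Cl n)) := by
      rw [Submodule.span_le]
      rintro _ ⟨B, rfl⟩
      exact Submodule.span_mono (Set.image_subset_range _ _) (e_mul_eProd_mem B i)
    exact fun x hx => hle hx
  rintro x -
  induction x using CliffordAlgebra.left_induction with
  | algebraMap r =>
    rw [Algebra.algebraMap_eq_smul_one]
    exact Submodule.smul_mem _ _ (Submodule.subset_span ⟨∅, eProd_empty⟩)
  | add x y hx hy => exact Submodule.add_mem _ hx hy
  | ι_mul x v hx =>
    have hv : CliffordAlgebra.ι (cliffordForm n) v = ∑ i, v i • e i := by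
      conv_lhs => rw [← (EuclideanSpace.basisFun (Fin n) ℝ).sum_repr v]
      simp [map_sum, e]
    rw [hv, Finset.sum_mul]
    refine Submodule.sum_mem _ fun i _ => ?_
    rw [smul_mul_assoc]
    exact Submodule.smul_mem _ _ (hmul i x hx)

/-- The basis `(e_A)_A` of `ℝ_n`. -/
noncomputable def eBasis (n : ℕ) : Module.Basis (Finset (Fin n)) ℝ (Cl n) :=
  Module.Basis.mk (eProd_linearIndependent n) (eProd_span n)

/-- The coordinates `a = ∑_A a_A e_A ↦ (a_A)_A`. -/
noncomputable def coords (n : ℕ) : Cl n ≃ₗ[ℝ] EuclideanSpace ℝ (Finset (Fin n)) :=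
  (eBasis n).equivFun.trans (WithLp.linearEquiv 2 ℝ (Finset (Fin n) → ℝ)).symm

/-- The norm `|a|² = ∑_A a_A²` on `ℝ_n`. -/
noncomputable instance instNormedAddCommGroupCl (n : ℕ) : NormedAddCommGroup (Cl n) :=
  NormedAddCommGroup.induced (Cl n) (EuclideanSpace ℝ (Finset (Fin n))) (coords n)
    (coords n).injective

noncomputable instance instNormedSpaceCl (n : ℕ) : NormedSpace ℝ (Cl n) :=
  NormedSpace.induced ℝ (Cl n) (EuclideanSpace ℝ (Finset (Fin n))) (coords n)

instance instFiniteDimensionalCl (n : ℕ) : FiniteDimensional ℝ (Cl n) :=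
  Module.Basis.finiteDimensional_of_finite (eBasis n)

instance instCompleteSpaceCl (n : ℕ) : CompleteSpace (Cl n) :=
  FiniteDimensional.complete ℝ (Cl n)

instance instIsTopologicalRingCl (n : ℕ) : IsTopologicalRing (Cl n) where
  continuous_mul := by
    let m : Cl n →ₗ[ℝ] Cl n →L[ℝ] Cl n :=
      (LinearMap.toContinuousLinearMap (𝕜 := ℝ) (E := Cl n) (F' := Cl n)).toLinearMap ∘ₗ
        LinearMap.mul ℝ (Cl n)
    have hm : Continuous m := m.continuous_of_finiteDimensional
    exact (hm.comp continuous_fst).clm_apply continuous_snd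

/-- `ℝ^{n+1}`, the space of paravectors `x = x_0 + x_1 e_1 + … + x_n e_n` with the Euclidean norm:
`x.fst` is `x_0` and `x.snd` is the vector part `x_1 e_1 + … + x_n e_n`. -/
abbrev Paravector (n : ℕ) : Type := WithLp 2 (ℝ × EuclideanSpace ℝ (Fin n))

/-- A paravector as an element of `ℝ_n`. -/
noncomputable def Paravector.toCl {n : ℕ} (x : Paravector n) : Cl n :=
  algebraMap ℝ (Cl n) x.fst + vec x.snd

/-- The sphere `𝕊` of unit vectors `I = x_1 e_1 + … + x_n e_n`. -/
def unitVectors (n : ℕ) : Set (EuclideanSpace ℝ (Fin n)) := Metric.sphere 0 1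

/-- The point `u + I v` of the plane `L_I = ℝ + I ℝ`. -/
noncomputable def slicePoint {n : ℕ} (I : EuclideanSpace ℝ (Fin n)) (u v : ℝ) : Paravector n :=
  WithLp.toLp 2 (u, v • I)

/-- The real number `u` as a paravector. -/
noncomputable def realPoint (n : ℕ) (u : ℝ) : Paravector n := WithLp.toLp 2 (u, 0)

/-- `I_x = x̲ / |x̲|`, where `x̲` is the vector part of the non-real paravector `x`
(and `0` if `x` is real). -/
noncomputable def imUnit {n : ℕ} (x : Paravector n) : EuclideanSpace ℝ (Fin n) :=
  ‖x.snd‖⁻¹ • x.snd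

/-- Left slice monogenic functions on an open set `U ⊆ ℝ^{n+1}` (the values of `f` outside `U`
play no role). -/
structure IsLeftSliceMonogenicOn {n : ℕ} (f : Paravector n → Cl n) (U : Set (Paravector n)) :
    Prop where
  isOpen : IsOpen U
  differentiableAt : ∀ x ∈ U, DifferentiableAt ℝ f x
  cauchyRiemann : ∀ I ∈ unitVectors n, ∀ u v : ℝ, slicePoint I u v ∈ U →
    (1 / 2 : ℝ) • (deriv (fun s => f (slicePoint I s v)) u +
      vec I * deriv (fun t => f (slicePoint I u t)) v) = 0

/-- The one-dimensional left-sided Clifford Fourier transform of `f ∈ L¹(ℝ)`,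
`w ↦ (2π)^{-1/2} ∫ e^{-I u w} f(u) du`. -/
noncomputable def cliffordFourier {n : ℕ} (I : EuclideanSpace ℝ (Fin n)) (f : ℝ → Cl n) (w : ℝ) :
    Cl n :=
  (1 / Real.sqrt (2 * Real.pi)) • ∫ u : ℝ, NormedSpace.exp (-((u * w) • vec I)) * f u

/-- `g` is the (a.e. unique) one-dimensional left-sided Clifford Fourier transform of
`f ∈ L²(ℝ)`: the limit in `L²(ℝ)` of the transforms of the truncations of `f` to `[-T, T]`. -/
def IsCliffordFourierL2 {n : ℕ} (I : EuclideanSpace ℝ (Fin n)) (f g : ℝ → Cl n) : Prop :=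
  MemLp g 2 volume ∧
    Tendsto (fun T : ℝ => eLpNorm
      (fun w => g w - cliffordFourier I ((Set.Icc (-T) T).indicator f) w) 2 volume)
      atTop (𝓝 0)

/-- The left slice monogenic Paley–Wiener space `PW²_B(ℝ^{n+1})`. The support of an `L²` function
lies in `[-B, B]` iff the function vanishes almost everywhere off `[-B, B]`. -/
def paleyWiener (n : ℕ) (B : ℝ) : Set (Paravector n → Cl n) :=
  {f | IsLeftSliceMonogenicOn f Set.univ ∧
    MemLp (fun u : ℝ => f (realPoint n u)) 2 volume ∧
    ∀ I ∈ unitVectors n, ∃ g : ℝ → Cl n,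
      IsCliffordFourierL2 I (fun u : ℝ => f (realPoint n u)) g ∧
      ∀ᵐ w : ℝ, w ∉ Set.Icc (-B) B → g w = 0}

/-- The slice extension to `ℝ^{n+1}` of a function `h` on the plane `L_I`, where `h u v` is the
value at `u + I v`:
`ext(h)(u + J v) = ½ [h(u - I v) + h(u + I v)] + (J I / 2) [h(u - I v) - h(u + I v)]`.
Here `u = x_0`, `v = |x̲|` and `J = I_x`; for real `x` the second term vanishes. -/
noncomputable def sliceExt {n : ℕ} (I : EuclideanSpace ℝ (Fin n)) (h : ℝ → ℝ → Cl n)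
    (x : Paravector n) : Cl n :=
  (1 / 2 : ℝ) • (h x.fst (-‖x.snd‖) + h x.fst ‖x.snd‖) +
    (1 / 2 : ℝ) • ((vec (imUnit x) * vec I) * (h x.fst (-‖x.snd‖) - h x.fst ‖x.snd‖))

/-- The kernel of the plane `L_I`,
`K_{B,L_I}(u + I v, ξ + I η) = (1/2π) ∫_{-B}^{B} e^{I [(u + I v) - (ξ - I η)] w} dw`. -/
noncomputable def planeKernel {n : ℕ} (B : ℝ) (I : EuclideanSpace ℝ (Fin n)) (u v ξ η : ℝ) : Cl n :=
  (1 / (2 * Real.pi)) • ∫ w in (-B)..B,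
    NormedSpace.exp (w • (vec I *
      ((slicePoint I u v).toCl - (slicePoint I ξ (-η)).toCl)))

/-- The kernel `K_{B,ℝ^{n+1}}(x, ξ + I η)`, the slice extension in the first variable of the kernel
of the plane `L_I`. -/
noncomputable def kernel {n : ℕ} (B : ℝ) (I : EuclideanSpace ℝ (Fin n)) (x : Paravector n)
    (ξ η : ℝ) : Cl n :=
  sliceExt I (fun u v => planeKernel B I u v ξ η) x

end SliceMonogenic

open SliceMonogenic

/-! The claim reduces to the classical Paley–Wiener space on ℂ. A unit vector J satisfies J² = -1,
so u + iv ↦ u + Jv embeds ℂ in ℝ_n as an ℝ-algebra (`planeEmbedding`), and left multiplication by J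
makes ℝ_n a complex vector space. The values of f need not lie in L_J, so f is tested against the
functionals y ↦ ℓ(y) - iℓ(Jy) (`complexFunctional`), which are complex linear for this structure.
They separate points, turn the slice equation on L_J into holomorphy, and carry 𝓕_J to the complex
Fourier transform. The reproducing formula along L_J thus follows from the scalar one,
`eq_integral_sincKernel_mul`.

The scalar formula uses the duality between f and its L² transform g twice
(`integral_mul_angularFourier_of_tendsto`). Paired with functions whose transform is a test
function, it yields Fourier inversion on ℝ (`eq_integral_of_tendsto`), and the identity theorem
extends the inversion integral to all of ℂ. Paired with a truncated exponential, whose transform is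
the kernel, it turns that integral into the reproducing integral.

For real ξ, the scalar kernel k satisfies k(conj z) = conj k(z), because [-B, B] is symmetric. Its
values at u ± Iv are therefore a ± bI with a, b real and independent of I, and the slice extension
merely replaces I by I_x (`kernel_eq`). This is (2), and (1) is then the reproducing formula in the
plane of x. -/

namespace SliceMonogenic

/-! ### Duality for the complex Fourier transform on ℝ. -/

/-- The Fourier transform of an integrable `h : ℝ → ℂ` with angular frequency and without
normalizing factor. -/
noncomputable def angularFourier (h : ℝ → ℂ) (w : ℝ) : ℂ :=
  ∫ u : ℝ, Complex.exp (-((u * w : ℝ) * Complex.I)) * h u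

theorem norm_exp_neg_ofReal_mul_I (t : ℝ) : ‖Complex.exp (-((t : ℂ) * Complex.I))‖ = 1 := by
  rw [← neg_mul, ← Complex.ofReal_neg, Complex.norm_exp_ofReal_mul_I]

theorem integrable_exp_mul_prod {θ h : ℝ → ℂ} (hθ : Integrable θ) (hh : Integrable h) :
    Integrable (fun p : ℝ × ℝ =>
      Complex.exp (-((p.2 * p.1 : ℝ) * Complex.I)) * (θ p.1 * h p.2)) (volume.prod volume) := by
  refine (hθ.mul_prod hh).bdd_mul (c := 1) ?_ (Eventually.of_forall fun p => ?_)
  · exact (by fun_prop : Continuous fun p : ℝ × ℝ =>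
      Complex.exp (-((p.2 * p.1 : ℝ) * Complex.I))).aestronglyMeasurable
  · exact (norm_exp_neg_ofReal_mul_I _).le

theorem aestronglyMeasurable_angularFourier {h : ℝ → ℂ} (hh : Integrable h) :
    AEStronglyMeasurable (angularFourier h) volume := by
  refine Continuous.aestronglyMeasurable ?_
  refine continuous_of_dominated (bound := fun u => ‖h u‖) (fun w => ?_) (fun w => ?_) hh.norm ?_
  · exact (by fun_prop : Continuous fun u : ℝ =>
      Complex.exp (-((u * w : ℝ) * Complex.I))).aestronglyMeasurable.mul hh.1
  · refine Eventually.of_forall fun u => ?_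
    rw [norm_mul, norm_exp_neg_ofReal_mul_I, one_mul]
  · exact Eventually.of_forall fun u => by fun_prop

theorem norm_angularFourier_le (h : ℝ → ℂ) (w : ℝ) : ‖angularFourier h w‖ ≤ ∫ u, ‖h u‖ := by
  refine (norm_integral_le_integral_norm _).trans (le_of_eq ?_)
  congr 1 with u
  rw [norm_mul, norm_exp_neg_ofReal_mul_I, one_mul]

theorem integral_mul_angularFourier {θ h : ℝ → ℂ} (hθ : Integrable θ) (hh : Integrable h) :
    ∫ w, θ w * angularFourier h w = ∫ u, h u * angularFourier θ u := by
  have key := integral_integral_swap (f := fun w u : ℝ =>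
    Complex.exp (-((u * w : ℝ) * Complex.I)) * (θ w * h u)) (integrable_exp_mul_prod hθ hh)
  calc ∫ w, θ w * angularFourier h w
      = ∫ w, ∫ u, Complex.exp (-((u * w : ℝ) * Complex.I)) * (θ w * h u) := by
        congr 1 with w
        rw [angularFourier, ← integral_const_mul]
        congr 1 with u
        ring
    _ = ∫ u, ∫ w, Complex.exp (-((u * w : ℝ) * Complex.I)) * (θ w * h u) := key
    _ = ∫ u, h u * angularFourier θ u := by
        congr 1 with u
        rw [angularFourier, ← integral_const_mul]
        congr 1 with w
        rw [mul_comm u w]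
        ring

/-- The duality formula for a function `f` whose truncations have Fourier transforms converging
to `g` in `L²`. -/
theorem integral_mul_angularFourier_of_tendsto {f g θ : ℝ → ℂ}
    (hf : LocallyIntegrable f) (hg : MemLp g 2 volume)
    (hlim : Tendsto (fun T : ℝ => eLpNorm (fun w => g w -
      (1 / Real.sqrt (2 * Real.pi) : ℝ) * angularFourier ((Set.Icc (-T) T).indicator f) w)
        2 volume) atTop (𝓝 0))
    (hθ : Integrable θ) (hθ2 : MemLp θ 2 volume)
    (hfθ : Integrable fun u => f u * angularFourier θ u) :
    (1 / Real.sqrt (2 * Real.pi) : ℝ) * ∫ u, f u * angularFourier θ u = ∫ w, θ w * g w := by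
  set c : ℂ := ((1 / Real.sqrt (2 * Real.pi) : ℝ) : ℂ) with hc
  have hfT : ∀ T : ℝ, Integrable ((Set.Icc (-T) T).indicator f) := fun T =>
    (integrable_indicator_iff measurableSet_Icc).2 (hf.integrableOn_isCompact isCompact_Icc)
  -- The truncated pairings have two limits, compared at the end: here by exhausting ℝ with [-T, T].
  have h1 : Tendsto (fun T : ℝ => c * ∫ u, (Set.Icc (-T) T).indicator f u * angularFourier θ u)
      atTop (𝓝 (c * ∫ u, f u * angularFourier θ u)) := by
    refine Tendsto.const_mul c ?_
    have := (aecover_Icc (μ := (volume : Measure ℝ)) tendsto_neg_atTop_atBot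
      tendsto_id).integral_tendsto_of_countably_generated hfθ
    refine this.congr fun T => ?_
    rw [← integral_indicator measurableSet_Icc]
    congr 1 with u
    simp only [Set.indicator, id]
    split_ifs <;> simp
  -- Here duality for the integrable truncations moves the transform off θ, and Hölder with θ ∈ L²
  -- bounds the error by the assumed L² convergence.
  have h2 : Tendsto (fun T : ℝ => c * ∫ u, (Set.Icc (-T) T).indicator f u * angularFourier θ u)
      atTop (𝓝 (∫ w, θ w * g w)) := by
    rw [tendsto_iff_edist_tendsto_0]
    have hbound : Tendsto (fun T : ℝ => eLpNorm θ 2 volume * eLpNorm (fun w => g w -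
        c * angularFourier ((Set.Icc (-T) T).indicator f) w) 2 volume) atTop (𝓝 0) := by
      have := ENNReal.Tendsto.const_mul hlim (a := eLpNorm θ 2 volume)
        (Or.inr hθ2.eLpNorm_ne_top)
      simpa using this
    refine tendsto_of_tendsto_of_tendsto_of_le_of_le tendsto_const_nhds hbound
      (fun _ => zero_le) fun T => ?_
    have hm := aestronglyMeasurable_angularFourier (hfT T)
    have i1 : Integrable fun w => θ w * g w := hθ2.integrable_mul hg
    have i2 : Integrable fun w => θ w * (c * angularFourier ((Set.Icc (-T) T).indicator f) w) := by
      refine hθ.mul_bdd (c := ‖c‖ * ∫ u, ‖(Set.Icc (-T) T).indicator f u‖)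
        (hm.const_mul c) (Eventually.of_forall fun w => ?_)
      rw [norm_mul]
      gcongr
      exact norm_angularFourier_le _ _
    have e1 : c * ∫ u, (Set.Icc (-T) T).indicator f u * angularFourier θ u =
        ∫ w, θ w * (c * angularFourier ((Set.Icc (-T) T).indicator f) w) := by
      rw [← integral_mul_angularFourier hθ (hfT T), ← integral_const_mul]
      congr 1 with w
      ring
    rw [edist_comm, edist_eq_enorm_sub, e1, ← integral_sub i1 i2]
    refine (enorm_integral_le_lintegral_enorm _).trans ?_
    rw [← eLpNorm_one_eq_lintegral_enorm]
    have := eLpNorm_smul_le_mul_eLpNorm (p := 2) (q := 2) (r := 1) (μ := (volume : Measure ℝ))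
      (hg.1.sub (hm.const_mul c)) hθ2.1
    refine le_trans (le_of_eq ?_) this
    congr 1 with w
    simp [mul_sub]
  exact tendsto_nhds_unique h1 h2

/-! ### The scalar kernel. -/

/-- The Paley–Wiener kernel `z ↦ (1/2π) ∫_{-B}^{B} e^{izw} dw` of the complex plane. -/
noncomputable def sincKernel (B : ℝ) (z : ℂ) : ℂ :=
  (1 / (2 * Real.pi) : ℝ) * ∫ w in (-B)..B, Complex.exp (w * (Complex.I * z))

/-- Conjugating the exponential also flips the sign of i; the substitution w ↦ -w on the symmetric
interval undoes this. -/
theorem sincKernel_conj (B : ℝ) (z : ℂ) :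
    sincKernel B (starRingEnd ℂ z) = starRingEnd ℂ (sincKernel B z) := by
  have hconj : starRingEnd ℂ (∫ w in (-B)..B, Complex.exp (w * (Complex.I * z))) =
      ∫ w in (-B)..B, starRingEnd ℂ (Complex.exp (w * (Complex.I * z))) := by
    simp only [intervalIntegral, map_sub, integral_conj]
  have hneg := intervalIntegral.integral_comp_neg (a := -B) (b := B)
    (fun w : ℝ => Complex.exp (w * (Complex.I * starRingEnd ℂ z)))
  rw [neg_neg] at hneg
  rw [sincKernel, sincKernel, map_mul, Complex.conj_ofReal, hconj, ← hneg]
  simp only [← Complex.exp_conj, map_mul, Complex.conj_I, Complex.conj_ofReal]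
  congr! 4 with w
  push_cast
  ring

theorem continuous_sincKernel (B : ℝ) : Continuous (sincKernel B) := by
  unfold sincKernel
  fun_prop

theorem norm_exp_mul_I_le {B w : ℝ} (hw : |w| ≤ B) (z : ℂ) :
    ‖Complex.exp (w * (Complex.I * z))‖ ≤ Real.exp (B * |z.im|) := by
  rw [Complex.norm_exp, Real.exp_le_exp]
  simp only [Complex.mul_re, Complex.ofReal_re, Complex.I_re, Complex.I_im, Complex.ofReal_im]
  calc _ = -(w * z.im) := by ring
    _ ≤ |w * z.im| := neg_le_abs _
    _ = |w| * |z.im| := abs_mul _ _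
    _ ≤ B * |z.im| := by gcongr

/-- Im(z - ξ) does not depend on ξ, so the exponentials are uniformly bounded and so is the kernel.
Integrating the exponential explicitly gives decay of order 1/|z - ξ|, which is square integrable at
infinity. -/
theorem memLp_sincKernel {B : ℝ} (hB : 0 < B) (z : ℂ) :
    MemLp (fun ξ : ℝ => sincKernel B (z - ξ)) 2 volume := by
  have hcont : Continuous fun ξ : ℝ => sincKernel B (z - ξ) :=
    (continuous_sincKernel B).comp (by fun_prop)
  set M := Real.exp (B * |z.im|)
  have him : ∀ ξ : ℝ, (z - ξ).im = z.im := fun ξ => by simp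
  have hc : ‖((1 / (2 * Real.pi) : ℝ) : ℂ)‖ ≤ 1 := by
    rw [Complex.norm_real, Real.norm_of_nonneg (by positivity), div_le_one (by positivity)]
    linarith [Real.pi_gt_three]
  have h1 : ∀ ξ : ℝ, ‖sincKernel B (z - ξ)‖ ≤ M * (2 * B) := by
    intro ξ
    rw [sincKernel, norm_mul]
    refine (mul_le_of_le_one_left (norm_nonneg _) hc).trans ?_
    refine (intervalIntegral.norm_integral_le_of_norm_le_const (C := M) fun w hw => ?_).trans
      (le_of_eq ?_)
    · rw [Set.uIoc_of_le (by linarith)] at hw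
      have := norm_exp_mul_I_le (abs_le.2 ⟨hw.1.le, hw.2⟩) (z - ξ)
      rwa [him] at this
    · rw [abs_of_pos (by linarith)]
      ring
  have h2 : ∀ ξ : ℝ, ‖z - ξ‖ * ‖sincKernel B (z - ξ)‖ ≤ 2 * M := by
    intro ξ
    rcases eq_or_ne (z - ξ) 0 with h0 | h0
    · rw [h0, norm_zero, zero_mul]
      positivity
    have hI : Complex.I * (z - ξ) ≠ 0 := mul_ne_zero Complex.I_ne_zero h0
    have e1 : sincKernel B (z - ξ) = (1 / (2 * Real.pi) : ℝ) *
        ((Complex.exp (B * (Complex.I * (z - ξ))) -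
          Complex.exp ((-B : ℝ) * (Complex.I * (z - ξ)))) / (Complex.I * (z - ξ))) := by
      rw [sincKernel]
      congr 1
      rw [mul_comm (B : ℂ), mul_comm ((-B : ℝ) : ℂ), ← integral_exp_mul_complex hI]
      simp only [mul_comm]
    rw [e1, norm_mul, norm_div, norm_mul Complex.I, Complex.norm_I, one_mul]
    have hz : 0 < ‖z - ξ‖ := norm_pos_iff.2 h0
    have h3 := norm_exp_mul_I_le (abs_of_pos hB).le (z - ξ)
    have h4 := norm_exp_mul_I_le (w := -B) (by rw [abs_neg, abs_of_pos hB]) (z - ξ)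
    rw [him] at h3 h4
    calc _ = ‖((1 / (2 * Real.pi) : ℝ) : ℂ)‖ * ‖Complex.exp (B * (Complex.I * (z - ξ))) -
          Complex.exp ((-B : ℝ) * (Complex.I * (z - ξ)))‖ := by field_simp
      _ ≤ 1 * (M + M) := by
        gcongr
        exact (norm_sub_le _ _).trans (add_le_add h3 h4)
      _ = 2 * M := by ring
  rw [memLp_two_iff_integrable_sq_norm hcont.aestronglyMeasurable]
  -- The constant comes from adding the squares of `h1` and `h2`, which bounds (1 + |z - ξ|²) times
  -- the squared norm of the kernel.
  have hint : Integrable fun ξ : ℝ =>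
      ((M * (2 * B)) ^ 2 + (2 * M) ^ 2) * (1 + (ξ - z.re) ^ 2)⁻¹ :=
    (integrable_inv_one_add_sq.comp_sub_right z.re).const_mul _
  refine hint.mono' (hcont.norm.pow 2).aestronglyMeasurable (Eventually.of_forall fun ξ => ?_)
  rw [Real.norm_of_nonneg (by positivity), ← div_eq_mul_inv, le_div_iff₀ (by positivity)]
  have h5 : (ξ - z.re) ^ 2 ≤ ‖z - ξ‖ ^ 2 := by
    have := Complex.abs_re_le_norm (z - ξ)
    rw [← sq_abs, abs_sub_comm]
    simp only [Complex.sub_re, Complex.ofReal_re] at this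
    gcongr
  have h6 := pow_le_pow_left₀ (norm_nonneg _) (h1 ξ) 2
  have h7 := pow_le_pow_left₀ (by positivity) (h2 ξ) 2
  rw [mul_pow ‖z - ξ‖] at h7
  nlinarith [mul_le_mul_of_nonneg_right h5 (sq_nonneg ‖sincKernel B (z - ξ)‖)]

/-! ### Fourier inversion and the scalar reproducing formula. -/

/-- An integral of exponentials over a compact interval is an entire function. -/
theorem differentiable_integral_exp_mul {B : ℝ} (hB : 0 ≤ B) {g : ℝ → ℂ}
    (hg : IntegrableOn g (Set.Icc (-B) B)) :
    Differentiable ℂ fun z : ℂ =>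
      ∫ w in Set.Icc (-B) B, Complex.exp (w * (Complex.I * z)) * g w := by
  intro z₀
  have hexp : ∀ z : ℂ, Continuous fun w : ℝ => Complex.exp (w * (Complex.I * z)) :=
    fun z => by fun_prop
  have hmem : ∀ᵐ w ∂(volume.restrict (Set.Icc (-B) B)), |w| ≤ B :=
    (ae_restrict_mem measurableSet_Icc).mono fun w hw => abs_le.2 hw
  have hmeas : ∀ z : ℂ, AEStronglyMeasurable (fun w : ℝ => Complex.exp (w * (Complex.I * z)) * g w)
      (volume.restrict (Set.Icc (-B) B)) := fun z => (hexp z).aestronglyMeasurable.mul hg.1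
  -- On the unit ball about z₀ one has |Im z| ≤ ‖z₀‖ + 1, which makes the bound on the derivative
  -- uniform in z.
  refine (hasDerivAt_integral_of_dominated_loc_of_deriv_le (𝕜 := ℂ)
    (bound := fun w => B * Real.exp (B * (‖z₀‖ + 1)) * ‖g w‖)
    (F' := fun z w => w * Complex.I * Complex.exp (w * (Complex.I * z)) * g w)
    (Metric.ball_mem_nhds z₀ one_pos) (Eventually.of_forall hmeas)
    ?_ ?_ ?_ (hg.norm.const_mul _) ?_).2.differentiableAt
  · refine Integrable.bdd_mul (c := Real.exp (B * |z₀.im|)) hg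
      (hexp z₀).aestronglyMeasurable ?_
    exact hmem.mono fun w hw => norm_exp_mul_I_le hw z₀
  · exact ((by fun_prop : Continuous fun w : ℝ =>
      w * Complex.I * Complex.exp (w * (Complex.I * z₀))).aestronglyMeasurable).mul hg.1
  · refine hmem.mono fun w hw z hz => ?_
    rw [norm_mul, norm_mul, norm_mul, Complex.norm_I, mul_one, Complex.norm_real]
    have h1 : |z.im| ≤ ‖z₀‖ + 1 := by
      have h2 : ‖z - z₀‖ < 1 := by simpa [dist_eq_norm] using hz
      have h3 := norm_le_norm_add_norm_sub' z z₀
      linarith [Complex.abs_im_le_norm z]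
    gcongr
    · exact hw
    · refine (norm_exp_mul_I_le hw z).trans ?_
      gcongr
  · refine Eventually.of_forall fun w z _ => ?_
    have h : HasDerivAt (fun z : ℂ => (w : ℂ) * (Complex.I * z)) (w * Complex.I) z := by
      simpa [mul_assoc] using ((hasDerivAt_id z).const_mul Complex.I).const_mul (w : ℂ)
    refine (h.cexp.mul_const (g w)).congr_deriv ?_
    ring

open scoped FourierTransform ContDiff

/-- A compactly supported smooth function is the Fourier transform of an integrable and square
integrable function, given by the inversion formula. -/
theorem exists_angularFourier_eq {ψ : ℝ → ℂ} (hψ : ContDiff ℝ ∞ ψ) (hc : HasCompactSupport ψ) :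
    ∃ θ : ℝ → ℂ, Integrable θ ∧ MemLp θ 2 volume ∧ angularFourier θ = ψ ∧
      ∀ w, angularFourier (fun u => ψ (-u)) w = 2 * Real.pi * θ w := by
  set Ψ : SchwartzMap ℝ ℂ := hc.toSchwartzMap hψ with hΨ
  have hΨ' : (Ψ : ℝ → ℂ) = ψ := rfl
  -- The library transform has frequency 2πw; θ is η rescaled by 2π to pass to angular frequency.
  set η : SchwartzMap ℝ ℂ := 𝓕⁻ Ψ with hη
  have hpi : (2 * Real.pi) ≠ 0 := by positivity
  have hηΨ : 𝓕 (η : ℝ → ℂ) = ψ := by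
    rw [← SchwartzMap.fourier_coe, hη, FourierTransform.fourier_fourierInv_eq, hΨ']
  refine ⟨fun w => (1 / (2 * Real.pi) : ℝ) * η (w / (2 * Real.pi)),
    (η.integrable.comp_div hpi).const_mul _, MemLp.const_mul ?_ _, ?_, fun w => ?_⟩
  · rw [memLp_two_iff_integrable_sq_norm (by fun_prop)]
    have := (memLp_two_iff_integrable_sq_norm η.continuous.aestronglyMeasurable).1
      (η.memLp 2 volume)
    exact this.comp_div hpi
  · ext u
    rw [← hηΨ, Real.fourier_eq', angularFourier]
    have := Measure.integral_comp_div (fun w : ℝ =>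
      Complex.exp (-((2 * Real.pi * w * u : ℝ) * Complex.I)) *
        ((1 / (2 * Real.pi) : ℝ) * η w)) (2 * Real.pi)
    have e1 : ∀ w : ℝ, 2 * Real.pi * (w / (2 * Real.pi)) = w := fun w => by field_simp
    simp only [e1] at this
    rw [this, abs_of_pos (by positivity), ← integral_smul]
    congr 1 with w
    rw [Complex.real_smul, smul_eq_mul]
    have e2 : ((2 * Real.pi : ℝ) : ℂ) * ((1 / (2 * Real.pi) : ℝ) : ℂ) = 1 := by
      rw [← Complex.ofReal_mul]
      norm_cast
      field_simp
    calc _ = (((2 * Real.pi : ℝ) : ℂ) * ((1 / (2 * Real.pi) : ℝ) : ℂ)) *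
          (Complex.exp (-((2 * Real.pi * w * u : ℝ) * Complex.I)) * η w) := by ring
      _ = _ := by
        rw [e2, one_mul]
        congr 2
        simp only [RCLike.inner_apply, conj_trivial]
        push_cast
        ring
  · have h1 : angularFourier (fun u => ψ (-u)) w =
        ∫ u : ℝ, Complex.exp (((u * w : ℝ) * Complex.I)) * ψ u := by
      rw [angularFourier, ← integral_neg_eq_self]
      congr 1 with u
      simp
    beta_reduce
    rw [h1, hη, SchwartzMap.fourierInv_coe, Real.fourierInv_eq', hΨ', ← mul_assoc]
    have e2 : (2 * Real.pi : ℂ) * ((1 / (2 * Real.pi) : ℝ) : ℂ) = 1 := by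
      push_cast
      field_simp
    rw [e2, one_mul]
    congr 1 with u
    rw [smul_eq_mul]
    congr 2
    simp only [RCLike.inner_apply, conj_trivial]
    congr 2
    field_simp

theorem integrableOn_of_memLp_two {g : ℝ → ℂ} (hg : MemLp g 2 volume) (B : ℝ) :
    IntegrableOn g (Set.Icc (-B) B) :=
  (hg.locallyIntegrable (by norm_num)).integrableOn_isCompact isCompact_Icc

/-- The inversion formula for a continuous function whose Fourier transform in `L²` vanishes off
`[-B, B]`. -/
theorem eq_integral_of_tendsto {B : ℝ} (hB : 0 ≤ B) {f g : ℝ → ℂ} (hf : Continuous f)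
    (hg : MemLp g 2 volume)
    (hlim : Tendsto (fun T : ℝ => eLpNorm (fun w => g w -
      (1 / Real.sqrt (2 * Real.pi) : ℝ) * angularFourier ((Set.Icc (-T) T).indicator f) w)
        2 volume) atTop (𝓝 0))
    (hsupp : ∀ᵐ w : ℝ, w ∉ Set.Icc (-B) B → g w = 0) (u : ℝ) :
    f u = (1 / Real.sqrt (2 * Real.pi) : ℝ) *
      ∫ w in Set.Icc (-B) B, Complex.exp (w * (Complex.I * u)) * g w := by
  set c : ℂ := ((1 / Real.sqrt (2 * Real.pi) : ℝ) : ℂ) with hc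
  have hc2 : c * (2 * Real.pi * c) = 1 := by
    rw [hc]
    norm_cast
    have h : Real.sqrt (2 * Real.pi) ^ 2 = 2 * Real.pi := Real.sq_sqrt (by positivity)
    have h0 : Real.sqrt (2 * Real.pi) ≠ 0 := by positivity
    field_simp
    exact h.symm
  set P : ℝ → ℂ := fun u => c * ∫ w in Set.Icc (-B) B, Complex.exp (w * (Complex.I * u)) * g w
    with hP
  have hgB := integrableOn_of_memLp_two hg B
  have hPc : Continuous P := continuous_const.mul
    ((differentiable_integral_exp_mul hB hgB).continuous.comp Complex.continuous_ofReal)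
  set g₁ : ℝ → ℂ := (Set.Icc (-B) B).indicator g with hg₁
  have hg₁i : Integrable g₁ := (integrable_indicator_iff measurableSet_Icc).2 hgB
  have hgg : g =ᵐ[volume] g₁ := hsupp.mono fun w hw => by
    by_cases h : w ∈ Set.Icc (-B) B
    · rw [hg₁, Set.indicator_of_mem h]
    · rw [hg₁, Set.indicator_of_notMem h, hw h]
  have hPg : ∀ u, P u = c * angularFourier g₁ (-u) := by
    intro u
    simp only [hP, angularFourier, hg₁]
    rw [← integral_indicator measurableSet_Icc]
    congr 2 with w
    by_cases h : w ∈ Set.Icc (-B) B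
    · rw [Set.indicator_of_mem h, Set.indicator_of_mem h]
      congr 2
      push_cast
      ring
    · simp [Set.indicator_of_notMem h]
  -- Both sides are integrated against a test function φ, the transform of some θ. Duality turns
  -- each integral into a multiple of ∫ θ g, and the constants match because 2πc² = 1. Continuity
  -- then upgrades a.e. equality to equality.
  have hae : f =ᵐ[volume] P := by
    refine ae_eq_of_integral_contDiff_smul_eq hf.locallyIntegrable hPc.locallyIntegrable
      fun φ hφ hφc => ?_
    have hψ : ContDiff ℝ ∞ fun u => (φ u : ℂ) := Complex.ofRealCLM.contDiff.comp hφ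
    have hψc : HasCompactSupport fun u => (φ u : ℂ) :=
      hφc.comp_left (g := Complex.ofReal) Complex.ofReal_zero
    obtain ⟨θ, hθ, hθ2, hθψ, hψθ⟩ := exists_angularFourier_eq hψ hψc
    have hψi : Integrable fun u => (φ u : ℂ) := hψ.continuous.integrable_of_hasCompactSupport hψc
    have hint : Integrable fun u => f u * angularFourier θ u := by
      rw [hθψ]
      exact (hf.mul hψ.continuous).integrable_of_hasCompactSupport hψc.mul_left
    have k1 := integral_mul_angularFourier_of_tendsto hf.locallyIntegrable hg hlim hθ hθ2 hint
    rw [hθψ] at k1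
    have k2 := integral_mul_angularFourier hψi.comp_neg hg₁i
    simp only [hψθ] at k2
    have k3 : ∫ w, θ w * g w = ∫ w, θ w * g₁ w :=
      integral_congr_ae (hgg.mono fun w hw => by simp only [hw])
    have k4 : ∫ u, φ u • P u = c * ∫ u, (φ (-u) : ℂ) * angularFourier g₁ u := by
      rw [← integral_neg_eq_self, ← integral_const_mul]
      congr 1 with u
      rw [hPg, Complex.real_smul, neg_neg]
      ring
    have k5 : ∫ w, g₁ w * (2 * Real.pi * θ w) = 2 * Real.pi * ∫ w, θ w * g₁ w := by
      rw [← integral_const_mul]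
      congr 1 with w
      ring
    have k6 : ∫ u, φ u • f u = ∫ u, f u * (φ u : ℂ) := by
      congr 1 with u
      rw [Complex.real_smul, mul_comm]
    rw [k4, k2, k5, ← k3, ← k1, k6]
    linear_combination (-∫ u, f u * (φ u : ℂ)) * hc2
  exact congrFun ((hf.ae_eq_iff_eq volume hPc).1 hae) u

/-- The reproducing formula of the classical Paley–Wiener space. -/
theorem eq_integral_sincKernel_mul {B : ℝ} (hB : 0 < B) {F : ℂ → ℂ} (hF : Differentiable ℂ F)
    (hL : MemLp (fun u : ℝ => F u) 2 volume) {g : ℝ → ℂ} (hg : MemLp g 2 volume)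
    (hlim : Tendsto (fun T : ℝ => eLpNorm (fun w => g w - (1 / Real.sqrt (2 * Real.pi) : ℝ) *
      angularFourier ((Set.Icc (-T) T).indicator fun u : ℝ => F u) w) 2 volume) atTop (𝓝 0))
    (hsupp : ∀ᵐ w : ℝ, w ∉ Set.Icc (-B) B → g w = 0) (z : ℂ) :
    F z = ∫ ξ : ℝ, sincKernel B (z - ξ) * F ξ := by
  set c : ℂ := ((1 / Real.sqrt (2 * Real.pi) : ℝ) : ℂ) with hc
  have hc2 : ((1 / (2 * Real.pi) : ℝ) : ℂ) = c * c := by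
    rw [hc, ← Complex.ofReal_mul]
    congr 1
    rw [div_mul_div_comm, Real.mul_self_sqrt (by positivity), one_mul]
  have hc0 : c ≠ 0 := by
    rw [hc, Complex.ofReal_ne_zero]
    positivity
  have hgB := integrableOn_of_memLp_two hg B
  have hFc : Continuous fun u : ℝ => F u := hF.continuous.comp Complex.continuous_ofReal
  have hP : Differentiable ℂ fun z : ℂ =>
      c * ∫ w in Set.Icc (-B) B, Complex.exp (w * (Complex.I * z)) * g w :=
    (differentiable_integral_exp_mul hB.le hgB).const_mul c
  have hFP : F = fun z : ℂ =>
      c * ∫ w in Set.Icc (-B) B, Complex.exp (w * (Complex.I * z)) * g w := by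
    -- Two entire functions that agree on ℝ, which accumulates at 0, coincide.
    refine AnalyticOnNhd.eq_of_frequently_eq (z₀ := 0)
      (fun z _ => hF.analyticAt z) (fun z _ => hP.analyticAt z) ?_
    have ht : Tendsto (fun u : ℝ => (u : ℂ)) (𝓝[≠] 0) (𝓝[≠] 0) := by
      refine tendsto_nhdsWithin_iff.2 ⟨?_, ?_⟩
      · exact (Complex.continuous_ofReal.tendsto' 0 0 Complex.ofReal_zero).mono_left
          nhdsWithin_le_nhds
      · filter_upwards [self_mem_nhdsWithin] with u hu
        simpa using hu
    exact ht.frequently (Eventually.of_forall fun u =>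
      eq_integral_of_tendsto hB.le hFc hg hlim hsupp u).frequently
  -- This θ is chosen so that its transform at ξ is the kernel at z - ξ. The jumps at ±B are
  -- harmless, as duality only asks for θ in L¹ ∩ L² and an integrable pairing.
  set θ : ℝ → ℂ := (Set.Icc (-B) B).indicator fun w =>
    (1 / (2 * Real.pi) : ℝ) * Complex.exp (w * (Complex.I * z)) with hθ
  have hcont : Continuous fun w : ℝ =>
      (1 / (2 * Real.pi) : ℝ) * Complex.exp (w * (Complex.I * z)) := by fun_prop
  have hθi : Integrable θ :=
    (integrable_indicator_iff measurableSet_Icc).2 (hcont.continuousOn.integrableOn_Icc)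
  have hθ2 : MemLp θ 2 volume := by
    rw [hθ, memLp_indicator_iff_restrict measurableSet_Icc]
    rw [memLp_two_iff_integrable_sq_norm hcont.aestronglyMeasurable]
    exact (hcont.norm.pow 2).continuousOn.integrableOn_Icc
  have hθk : ∀ ξ : ℝ, angularFourier θ ξ = sincKernel B (z - ξ) := by
    intro ξ
    rw [angularFourier, sincKernel, intervalIntegral.integral_of_le (by linarith),
      ← integral_Icc_eq_integral_Ioc, ← integral_indicator measurableSet_Icc,
      ← integral_const_mul]
    congr 1 with w
    rw [hθ]
    by_cases h : w ∈ Set.Icc (-B) B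
    · rw [Set.indicator_of_mem h, Set.indicator_of_mem h, mul_left_comm, ← Complex.exp_add]
      congr 2
      push_cast
      ring
    · simp [Set.indicator_of_notMem h]
  have hint : Integrable fun ξ : ℝ => F ξ * angularFourier θ ξ := by
    simp only [hθk]
    exact hL.integrable_mul (memLp_sincKernel hB z)
  have key := integral_mul_angularFourier_of_tendsto hFc.locallyIntegrable hg hlim hθi hθ2 hint
  have e1 : ∫ w, θ w * g w = c * c *
      ∫ w in Set.Icc (-B) B, Complex.exp (w * (Complex.I * z)) * g w := by
    rw [← integral_const_mul, ← integral_indicator measurableSet_Icc]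
    congr 1 with w
    rw [hθ]
    by_cases h : w ∈ Set.Icc (-B) B
    · rw [Set.indicator_of_mem h, Set.indicator_of_mem h, hc2]
      ring
    · simp [Set.indicator_of_notMem h]
  rw [e1, mul_assoc] at key
  have e2 := mul_left_cancel₀ hc0 key
  calc F z = c * ∫ w in Set.Icc (-B) B, Complex.exp (w * (Complex.I * z)) * g w :=
        congrFun hFP z
    _ = ∫ ξ : ℝ, F ξ * angularFourier θ ξ := e2.symm
    _ = _ := by
      congr 1 with ξ
      rw [hθk, mul_comm]

/-! ### The planes L_J and the extended kernel. -/

variable {n : ℕ} {I J : EuclideanSpace ℝ (Fin n)}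

theorem vec_mul_self (hJ : J ∈ unitVectors n) : vec J * vec J = -1 := by
  rw [CliffordAlgebra.ι_sq_scalar, cliffordForm_apply, mem_sphere_zero_iff_norm.1 hJ]
  simp

/-- The embedding `u + iv ↦ u + Jv` of `ℂ` as the plane `L_J`. -/
noncomputable def planeEmbedding (J : EuclideanSpace ℝ (Fin n)) (hJ : J ∈ unitVectors n) :
    ℂ →ₐ[ℝ] Cl n :=
  Complex.liftAux (vec J) (vec_mul_self hJ)

theorem planeEmbedding_apply (hJ : J ∈ unitVectors n) (z : ℂ) :
    planeEmbedding J hJ z = algebraMap ℝ (Cl n) z.re + z.im • vec J := rfl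

theorem continuous_planeEmbedding (hJ : J ∈ unitVectors n) : Continuous (planeEmbedding J hJ) :=
  (planeEmbedding J hJ).toLinearMap.continuous_of_finiteDimensional

theorem planeEmbedding_I (hJ : J ∈ unitVectors n) : planeEmbedding J hJ Complex.I = vec J := by
  simp [planeEmbedding_apply]

/-- A continuous algebra homomorphism can be applied termwise to the exponential series. -/
theorem planeEmbedding_exp (hJ : J ∈ unitVectors n) (z : ℂ) :
    planeEmbedding J hJ (Complex.exp z) = NormedSpace.exp (planeEmbedding J hJ z) := by
  rw [Complex.exp_eq_exp_ℂ, NormedSpace.exp_eq_tsum ℝ, NormedSpace.exp_eq_tsum ℝ]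
  refine ((NormedSpace.expSeries_summable' (𝕂 := ℝ) z).hasSum.map (planeEmbedding J hJ)
    (continuous_planeEmbedding hJ)).tsum_eq.symm.trans ?_
  simp only [Function.comp_def, map_smul, map_pow]

theorem toCl_slicePoint (hJ : J ∈ unitVectors n) (u v : ℝ) :
    (slicePoint J u v).toCl = planeEmbedding J hJ ⟨u, v⟩ := by
  simp [planeEmbedding_apply, Paravector.toCl, slicePoint]

theorem exp_slicePoint (hJ : J ∈ unitVectors n) (w u v ξ : ℝ) :
    NormedSpace.exp (w • (vec J * ((slicePoint J u v).toCl - algebraMap ℝ (Cl n) ξ))) =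
      planeEmbedding J hJ (Complex.exp (w * (Complex.I * (⟨u, v⟩ - ξ)))) := by
  rw [planeEmbedding_exp, toCl_slicePoint hJ, ← planeEmbedding_I hJ,
    ← (planeEmbedding J hJ).commutes ξ, ← map_sub, ← map_mul, ← map_smul]
  simp [Complex.real_smul]

theorem integral_exp_slicePoint (hJ : J ∈ unitVectors n) (B u v ξ : ℝ) :
    (1 / (2 * Real.pi)) • ∫ w in (-B)..B,
      NormedSpace.exp (w • (vec J * ((slicePoint J u v).toCl - algebraMap ℝ (Cl n) ξ))) =
      planeEmbedding J hJ (sincKernel B (⟨u, v⟩ - ξ)) := by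
  let j : ℂ →L[ℝ] Cl n := (planeEmbedding J hJ).toLinearMap.toContinuousLinearMap
  have hj : ∀ z, planeEmbedding J hJ z = j z := fun z => rfl
  have hc : Continuous fun w : ℝ => Complex.exp (w * (Complex.I * (⟨u, v⟩ - (ξ : ℂ)))) := by
    fun_prop
  simp only [exp_slicePoint hJ]
  rw [sincKernel, ← Complex.real_smul, map_smul]
  congr 1
  simp only [hj]
  exact j.intervalIntegral_comp_comm (hc.intervalIntegrable _ _)

theorem planeKernel_eq (hI : I ∈ unitVectors n) (B u v ξ : ℝ) :
    planeKernel B I u v ξ 0 = planeEmbedding I hI (sincKernel B (⟨u, v⟩ - ξ)) := by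
  rw [← integral_exp_slicePoint hI, planeKernel]
  simp [slicePoint, Paravector.toCl]

theorem eq_slicePoint (x : Paravector n) (hx : x.snd ≠ 0 → J = imUnit x) :
    x = slicePoint J x.fst ‖x.snd‖ := by
  have h : ‖x.snd‖ • J = x.snd := by
    by_cases h0 : x.snd = 0
    · simp [h0]
    · rw [hx h0, imUnit, smul_inv_smul₀ (norm_ne_zero_iff.2 h0)]
  rw [slicePoint, h]
  rfl

theorem imUnit_mem {x : Paravector n} (hx : x.snd ≠ 0) : imUnit x ∈ unitVectors n := by
  rw [unitVectors, mem_sphere_zero_iff_norm, imUnit, norm_smul, norm_inv, norm_norm,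
    inv_mul_cancel₀ (norm_ne_zero_iff.2 hx)]

/-- The right-hand side does not involve I: by conjugation symmetry the half-sum in the slice
extension is Re k, and the half-difference is -(Im k) I, which I_x I turns into (Im k) I_x since I²
= -1. -/
theorem kernel_eq (hI : I ∈ unitVectors n) (hJ : J ∈ unitVectors n) (B : ℝ) (x : Paravector n)
    (hx : x.snd ≠ 0 → J = imUnit x) (ξ : ℝ) :
    kernel B I x ξ 0 = planeEmbedding J hJ (sincKernel B (⟨x.fst, ‖x.snd‖⟩ - ξ)) := by
  set k := sincKernel B (⟨x.fst, ‖x.snd‖⟩ - ξ) with hk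
  have h1 : planeKernel B I x.fst ‖x.snd‖ ξ 0 = planeEmbedding I hI k := planeKernel_eq hI _ _ _ _
  have h2 : planeKernel B I x.fst (-‖x.snd‖) ξ 0 =
      planeEmbedding I hI (starRingEnd ℂ k) := by
    rw [planeKernel_eq hI, hk, ← sincKernel_conj]
    congr 2
    apply Complex.ext <;> simp
  have h3 : x.snd = 0 → k.im = 0 := by
    intro h0
    rw [← Complex.conj_eq_iff_im, hk, ← sincKernel_conj]
    congr 1
    apply Complex.ext <;> simp [h0]
  -- For real x, `imUnit x` is 0 and J is arbitrary; both terms vanish because k is then real.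
  have h4 : k.im • vec (imUnit x) = k.im • vec J := by
    by_cases h0 : x.snd = 0
    · rw [h3 h0, zero_smul, zero_smul]
    · rw [hx h0]
  have h5 : planeEmbedding I hI (starRingEnd ℂ k) - planeEmbedding I hI k =
      (-2 * k.im) • vec I := by
    simp only [planeEmbedding_apply, Complex.conj_re, Complex.conj_im]
    module
  have h6 : planeEmbedding I hI (starRingEnd ℂ k) + planeEmbedding I hI k =
      (2 : ℝ) • algebraMap ℝ (Cl n) k.re := by
    simp only [planeEmbedding_apply, Complex.conj_re, Complex.conj_im]
    module
  rw [kernel, sliceExt, h1, h2, h5, h6, mul_smul_comm, mul_assoc, vec_mul_self hI,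
    planeEmbedding_apply, ← h4, mul_neg, mul_one]
  module

/-! ### Reduction from ℝ_n to ℂ by complex functionals. -/

/-- The complex functional on `ℝ_n`, with the complex structure given by left multiplication by
`J`, with real part `ℓ`. -/
noncomputable def complexFunctional (J : EuclideanSpace ℝ (Fin n)) (ℓ : Cl n →ₗ[ℝ] ℝ) :
    Cl n →L[ℝ] ℂ :=
  LinearMap.toContinuousLinearMap
    { toFun := fun y => ⟨ℓ y, -ℓ (vec J * y)⟩
      map_add' := fun x y => by
        apply Complex.ext
        · simp
        · simp [mul_add, add_comm]
      map_smul' := fun r y => by apply Complex.ext <;> simp }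

theorem complexFunctional_apply (ℓ : Cl n →ₗ[ℝ] ℝ) (y : Cl n) :
    complexFunctional J ℓ y = ⟨ℓ y, -ℓ (vec J * y)⟩ := rfl

theorem complexFunctional_mul (hJ : J ∈ unitVectors n) (ℓ : Cl n →ₗ[ℝ] ℝ) (z : ℂ) (y : Cl n) :
    complexFunctional J ℓ (planeEmbedding J hJ z * y) = z * complexFunctional J ℓ y := by
  have h1 : planeEmbedding J hJ z * y = z.re • y + z.im • (vec J * y) := by
    rw [planeEmbedding_apply, add_mul, smul_mul_assoc, ← Algebra.smul_def]
  have h2 : vec J * (vec J * y) = -y := by rw [← mul_assoc, vec_mul_self hJ, neg_one_mul]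
  rw [h1]
  apply Complex.ext
  · simp [complexFunctional_apply]
  · simp [complexFunctional_apply, mul_add, h2]
    ring

/-- The coordinates in `eBasis`, taken as real parts, already separate points. -/
theorem ext_complexFunctional (J : EuclideanSpace ℝ (Fin n)) {x y : Cl n}
    (h : ∀ ℓ, complexFunctional J ℓ x = complexFunctional J ℓ y) : x = y := by
  refine (eBasis n).ext_elem fun A => ?_
  exact congrArg Complex.re (h ((eBasis n).coord A))

theorem exp_neg_smul_vec (hJ : J ∈ unitVectors n) (t : ℝ) :
    NormedSpace.exp (-(t • vec J)) =
      planeEmbedding J hJ (Complex.exp (-((t : ℂ) * Complex.I))) := by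
  rw [planeEmbedding_exp, ← planeEmbedding_I hJ, ← map_smul, ← map_neg, Complex.real_smul]

/-- The factor e^{-Juw} stands on the left of f, so complex linearity pulls it out as e^{-iuw}. -/
theorem complexFunctional_cliffordFourier (hJ : J ∈ unitVectors n) (ℓ : Cl n →ₗ[ℝ] ℝ)
    {f : ℝ → Cl n} (hf : Continuous f) (T w : ℝ) :
    complexFunctional J ℓ (cliffordFourier J ((Set.Icc (-T) T).indicator f) w) =
      (1 / Real.sqrt (2 * Real.pi) : ℝ) *
        angularFourier ((Set.Icc (-T) T).indicator fun u => complexFunctional J ℓ (f u)) w := by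
  have hc : Continuous fun u : ℝ =>
      planeEmbedding J hJ (Complex.exp (-((u * w : ℝ) * Complex.I))) * f u :=
    ((continuous_planeEmbedding hJ).comp (by fun_prop)).mul hf
  have he : (fun u : ℝ => NormedSpace.exp (-((u * w) • vec J)) * (Set.Icc (-T) T).indicator f u) =
      (Set.Icc (-T) T).indicator fun u =>
        planeEmbedding J hJ (Complex.exp (-((u * w : ℝ) * Complex.I))) * f u := by
    ext u
    rw [exp_neg_smul_vec hJ]
    by_cases h : u ∈ Set.Icc (-T) T <;> simp [h]
  rw [cliffordFourier, map_smul, Complex.real_smul, angularFourier, he]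
  congr 1
  rw [← ContinuousLinearMap.integral_comp_comm _
    ((integrable_indicator_iff measurableSet_Icc).2 hc.continuousOn.integrableOn_Icc)]
  congr 1 with u
  by_cases h : u ∈ Set.Icc (-T) T
  · simp only [Set.indicator_of_mem h, complexFunctional_mul]
  · simp [Set.indicator_of_notMem h]

/-- Slice monogenic functions are holomorphic on every plane. -/
theorem differentiable_complexFunctional_comp (hJ : J ∈ unitVectors n) (ℓ : Cl n →ₗ[ℝ] ℝ)
    {f : Paravector n → Cl n} (hf : IsLeftSliceMonogenicOn f Set.univ) :
    Differentiable ℂ fun z : ℂ => complexFunctional J ℓ (f (slicePoint J z.re z.im)) := by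
  intro z
  let p : ℂ →L[ℝ] Paravector n := LinearMap.toContinuousLinearMap
    { toFun := fun z => slicePoint J z.re z.im
      map_add' := fun x y => by
        simp only [slicePoint, Complex.add_re, Complex.add_im, add_smul, ← WithLp.toLp_add,
          Prod.mk_add_mk]
      map_smul' := fun r x => by
        simp only [slicePoint, Complex.smul_re, Complex.smul_im, smul_eq_mul, mul_smul,
          RingHom.id_apply, ← WithLp.toLp_smul, Prod.smul_mk] }
  set A := fderiv ℝ f (p z)
  have hfA : HasFDerivAt f A (p z) := (hf.differentiableAt _ (Set.mem_univ _)).hasFDerivAt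
  have hd : HasFDerivAt (fun z : ℂ => complexFunctional J ℓ (f (slicePoint J z.re z.im)))
      ((complexFunctional J ℓ).comp (A.comp p)) z :=
    (complexFunctional J ℓ).hasFDerivAt.comp z (hfA.comp z p.hasFDerivAt)
  have hfp : HasFDerivAt (fun z : ℂ => f (p z)) (A.comp p) z := hfA.comp z p.hasFDerivAt
  have hu : HasDerivAt (fun s : ℝ => (⟨s, z.im⟩ : ℂ)) 1 z.re := by
    have := (Complex.ofRealCLM.hasDerivAt (x := z.re)).add_const (z.im * Complex.I)
    refine (this.congr_deriv (by simp)).congr_of_eventuallyEq (Eventually.of_forall fun s => ?_)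
    apply Complex.ext <;> simp
  have hv : HasDerivAt (fun t : ℝ => (⟨z.re, t⟩ : ℂ)) Complex.I z.im := by
    have := ((Complex.ofRealCLM.hasDerivAt (x := z.im)).mul_const Complex.I).const_add (z.re : ℂ)
    refine (this.congr_deriv (by simp)).congr_of_eventuallyEq (Eventually.of_forall fun s => ?_)
    apply Complex.ext <;> simp
  have du : deriv (fun s => f (slicePoint J s z.im)) z.re = A (p 1) :=
    (HasFDerivAt.comp_hasDerivAt z.re (f := fun s : ℝ => (⟨s, z.im⟩ : ℂ)) hfp hu).deriv
  have dv : deriv (fun t => f (slicePoint J z.re t)) z.im = A (p Complex.I) :=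
    (HasFDerivAt.comp_hasDerivAt z.im (f := fun t : ℝ => (⟨z.re, t⟩ : ℂ)) hfp hv).deriv
  have hcr := hf.cauchyRiemann J hJ z.re z.im (Set.mem_univ _)
  rw [du, dv, smul_eq_zero_iff_right (by norm_num)] at hcr
  rw [differentiableAt_complex_iff_differentiableAt_real]
  refine ⟨hd.differentiableAt, ?_⟩
  rw [hd.fderiv]
  -- Multiplying the slice equation by J says that the real derivative sends i to J times its value
  -- at 1; applying the functional gives complex linearity.
  have h1 : A (p 1) = -(vec J * A (p Complex.I)) := eq_neg_of_add_eq_zero_left hcr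
  have h2 : vec J * A (p 1) = A (p Complex.I) := by
    rw [h1, mul_neg, ← mul_assoc, vec_mul_self hJ, neg_one_mul, neg_neg]
  simp only [ContinuousLinearMap.comp_apply, smul_eq_mul]
  rw [← h2, ← planeEmbedding_I hJ, complexFunctional_mul]

theorem tendsto_eLpNorm_clm_comp {E F : Type*} [NormedAddCommGroup E] [NormedSpace ℝ E]
    [NormedAddCommGroup F] [NormedSpace ℝ F] (φ : E →L[ℝ] F) {h : ℝ → ℝ → E}
    (hh : Tendsto (fun T => eLpNorm (h T) 2 volume) atTop (𝓝 0)) :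
    Tendsto (fun T => eLpNorm (fun w => φ (h T w)) 2 volume) atTop (𝓝 0) := by
  have hb : Tendsto (fun T => ENNReal.ofReal ‖φ‖ * eLpNorm (h T) 2 volume) atTop (𝓝 0) := by
    have := ENNReal.Tendsto.const_mul (a := ENNReal.ofReal ‖φ‖) hh (Or.inr ENNReal.ofReal_ne_top)
    rwa [mul_zero] at this
  exact tendsto_of_tendsto_of_tendsto_of_le_of_le tendsto_const_nhds hb (fun _ => zero_le)
    fun T => eLpNorm_le_mul_eLpNorm_of_ae_le_mul
      (Eventually.of_forall fun w => φ.le_opNorm _) 2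

theorem integrable_planeEmbedding_mul (hJ : J ∈ unitVectors n) {k : ℝ → ℂ} {f : ℝ → Cl n}
    (hk : MemLp k 2 volume) (hf : MemLp f 2 volume) :
    Integrable fun ξ => planeEmbedding J hJ (k ξ) * f ξ := by
  have h1 : (fun ξ => planeEmbedding J hJ (k ξ) * f ξ) =
      (fun ξ => (k ξ).re • f ξ + vec J * ((k ξ).im • f ξ)) := by
    ext ξ
    rw [planeEmbedding_apply, add_mul, smul_mul_assoc, mul_smul_comm, ← Algebra.smul_def]
  have hre : Integrable fun ξ => (k ξ).re • f ξ := memLp_one_iff_integrable.1 (hf.smul hk.re)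
  have him : Integrable fun ξ => (k ξ).im • f ξ := memLp_one_iff_integrable.1 (hf.smul hk.im)
  rw [h1]
  exact hre.add
    ((LinearMap.toContinuousLinearMap (LinearMap.mulLeft ℝ (vec J : Cl n))).integrable_comp him)

theorem slicePoint_zero (J : EuclideanSpace ℝ (Fin n)) (u : ℝ) :
    slicePoint J u 0 = realPoint n u := by
  simp [slicePoint, realPoint]

theorem continuous_comp_realPoint {f : Paravector n → Cl n}
    (hf : IsLeftSliceMonogenicOn f Set.univ) : Continuous fun u : ℝ => f (realPoint n u) := by
  have h1 : Continuous f := continuous_iff_continuousAt.2 fun x =>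
    (hf.differentiableAt x (Set.mem_univ x)).continuousAt
  refine h1.comp ?_
  exact (WithLp.prod_continuous_toLp 2 ℝ (EuclideanSpace ℝ (Fin n))).comp (by fun_prop)

/-! ### The reproducing formula on each plane, and the theorem. -/

theorem eq_integral_of_mem_paleyWiener {B : ℝ} (hB : 0 < B) {f : Paravector n → Cl n}
    (hf : f ∈ paleyWiener n B) (hJ : J ∈ unitVectors n) (u v : ℝ) :
    (Integrable fun ξ : ℝ =>
      planeEmbedding J hJ (sincKernel B (⟨u, v⟩ - ξ)) * f (realPoint n ξ)) ∧
    f (slicePoint J u v) =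
      ∫ ξ : ℝ, planeEmbedding J hJ (sincKernel B (⟨u, v⟩ - ξ)) * f (realPoint n ξ) := by
  obtain ⟨hmono, hL, hft⟩ := hf
  obtain ⟨g, ⟨hg, hlim⟩, hsupp⟩ := hft J hJ
  have hcont := continuous_comp_realPoint hmono
  have hint := integrable_planeEmbedding_mul hJ (memLp_sincKernel hB ⟨u, v⟩) hL
  refine ⟨hint, ext_complexFunctional J fun ℓ => ?_⟩
  have hreal : ∀ ξ : ℝ, complexFunctional J ℓ (f (slicePoint J (ξ : ℂ).re (ξ : ℂ).im)) =
      complexFunctional J ℓ (f (realPoint n ξ)) := fun ξ => by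
    rw [Complex.ofReal_re, Complex.ofReal_im, slicePoint_zero]
  rw [← ContinuousLinearMap.integral_comp_comm _ hint]
  simp only [complexFunctional_mul, ← hreal]
  refine eq_integral_sincKernel_mul hB (differentiable_complexFunctional_comp hJ ℓ hmono)
    (g := fun w => complexFunctional J ℓ (g w)) ?_ ((complexFunctional J ℓ).comp_memLp' hg) ?_
    (hsupp.mono fun w hw h => by rw [hw h, map_zero]) ⟨u, v⟩
  · simp only [hreal]
    exact (complexFunctional J ℓ).comp_memLp' hL
  · have := tendsto_eLpNorm_clm_comp (complexFunctional J ℓ) hlim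
    simp only [map_sub, complexFunctional_cliffordFourier hJ ℓ hcont] at this
    simpa only [hreal] using this

end SliceMonogenic

theorem mainTheorem7 (n : ℕ) (hn : 1 ≤ n) (B : ℝ) (hB : 0 < B) :
    -- the reproducing formula, for the kernel extended from any of the planes `L_I`
    (∀ f ∈ paleyWiener n B, ∀ I ∈ unitVectors n, ∀ x : Paravector n,
      Integrable (fun ξ : ℝ => kernel B I x ξ 0 * f (realPoint n ξ)) volume ∧
      f x = ∫ ξ : ℝ, kernel B I x ξ 0 * f (realPoint n ξ)) ∧
    -- the kernel; `J = I_x` if `x` is not real, and `J` is any unit vector if `x` is real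
    (∀ I ∈ unitVectors n, ∀ x : Paravector n, ∀ J ∈ unitVectors n,
      (x.snd ≠ 0 → J = imUnit x) → ∀ ξ : ℝ,
      kernel B I x ξ 0 = (1 / (2 * Real.pi)) • ∫ w in (-B)..B,
        NormedSpace.exp (w • (vec J * (x.toCl - algebraMap ℝ (Cl n) ξ)))) := by
  constructor
  · intro f hf I hI x
    -- A real x lies in every plane, so I itself serves as J.
    obtain ⟨J, hJ, hx⟩ : ∃ J ∈ unitVectors n, x.snd ≠ 0 → J = imUnit x := by
      by_cases h : x.snd = 0
      · exact ⟨I, hI, fun h' => absurd h h'⟩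
      · exact ⟨imUnit x, imUnit_mem h, fun _ => rfl⟩
    have key := eq_integral_of_mem_paleyWiener hB hf hJ x.fst ‖x.snd‖
    simp only [kernel_eq hI hJ B x hx]
    rwa [← eq_slicePoint x hx] at key
  · intro I hI x J hJ hx ξ
    rw [kernel_eq hI hJ B x hx, ← integral_exp_slicePoint hJ, ← eq_slicePoint x hx]
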